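/- All graphs are finite and simple. A \emph{unit realizer} of a graph $G=(V,E)$ assigns to each vertex $v$ a closed interval $I(v)=[\ell_v,\ell_v+1]\subset\mathbb{R}$ such that distinct vertices $u,v$ are adjacent if and only if $I(u)\cap I(v)\neq\emptyset$; $G$ is a \emph{unit interval graph} if it has a unit realizer. A vertex $r$ is a \emph{left anchor} of $G$ if $G$ has a unit realizer in which $\ell_r\le \ell_v$ for all $v\in V$. Two vertices $x,y$ are \emph{true twins} if $xy\in E$ and $N(x)\setminus\{y\}=N(y)\setminus\{x\}$. Two total orderings of $V$ are \emph{the same up to reversal and permutation of true twins} if one is obtained from the other, or from the reverse of the other, by a permutation of $V$ that maps each vertex to itself or to one of its true twins. \textbf{Theorem.} Let $G=(V,E)$ be a connected unit interval graph. Then the total orderings of $V$ of each of the following six kinds form one and the same class, which is a single equivalence class of orderings up to reversal and permutation of true twins. In particular orderings of each kind exist, and any two orderings, of the same or of different kinds in the list, are the same up to reversal and permutation of true twins. \begin{itemize} \item The \emph{interval orderings} of unit realizers of $G$: the vertices are sorted by the left bounds $\ell_v$ of some unit realizer (equal bounds in any order). \item The \emph{consecutive neighbourhood orderings}: for every vertex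 $v$ the closed neighbourhood $N[v]$ is consecutive in the ordering. \item The \emph{Left} (or \emph{Left-Right}) \emph{orderings}: whenever $a<b<c$ and $ac\in E$, also $ab\in E$ and $bc\in E$. \item The orderings $\mathtt{minBFS}(r)$, $r$ a left anchor of $G$: the order in which the vertices are visited by a breadth-first search (with a queue) started at $r$, where at each visit of a vertex its unmarked neighbours are appended to the queue in nondecreasing order of their degree in $G$, according to one sorting of $V$ by degree fixed beforehand with ties broken arbitrarily. \item The \emph{indifference orderings}: whenever $ab,bc\in E$ and $ac\notin E$ with $a\neq c$, either $a<b<c$ or $c<b<a$. \item The \emph{bisimplicial elimination orderings}: for every vertex $v$, the neighbours of $v$ that precede $v$ form a clique, and the neighbours of $v$ that follow $v$ form a clique. \end{itemize} -/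

import Mathlib

namespace UIG

variable {V : Type*}

/-- The assignment of the closed unit interval `[left v, left v + 1]` to each vertex `v` is a
(unit) realizer of `G`: distinct vertices are adjacent iff their intervals intersect. -/
def IsUnitRealizer (G : SimpleGraph V) (left : V → ℝ) : Prop :=
  ∀ u v : V, u ≠ v →
    (G.Adj u v ↔ (Set.Icc (left u) (left u + 1) ∩ Set.Icc (left v) (left v + 1)).Nonempty)

/-- `G` is a unit interval graph: it has a unit realizer. -/
def IsUnitIntervalGraph (G : SimpleGraph V) : Prop :=
  ∃ left : V → ℝ, IsUnitRealizer G left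

/-- `r` is a left anchor of `G`: its interval is leftmost in some unit realizer of `G`. -/
def IsLeftAnchor (G : SimpleGraph V) (r : V) : Prop :=
  ∃ left : V → ℝ, IsUnitRealizer G left ∧ ∀ v : V, left r ≤ left v

/-- Twins: `N(x) \ {y} = N(y) \ {x}`; true twins are moreover adjacent. -/
def TrueTwins (G : SimpleGraph V) (x y : V) : Prop :=
  G.neighborSet x \ {y} = G.neighborSet y \ {x} ∧ G.Adj x y

/-- Breadth first search with a queue, on adjacency lists `adj`, run for at most the given number
of rounds. The arguments after it are the list of visited vertices and the queue; a vertex is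
marked once it is in either. A round visits the head `u` of the queue and appends the unmarked
vertices of its adjacency list to the queue, in the order of that list. The result is the list of
visited vertices in order of visit. -/
noncomputable def bfsVisit (adj : V → List V) : ℕ → List V → List V → List V
  | 0, visited, _ => visited
  | _ + 1, visited, [] => visited
  | k + 1, visited, u :: queue =>
      bfsVisit adj k (visited ++ [u])
        (queue ++ open Classical in (adj u).filter (fun w => w ∉ visited ++ u :: queue))

variable [Fintype V]

/-- A total ordering of the finite set `V`, as the bijection sending each vertex to its
position. -/
abbrev VertexOrdering (V : Type*) [Fintype V] : Type _ :=
  V ≃ Fin (Fintype.card V)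

/-- The reverse (mirror) ordering. -/
def VertexOrdering.mirror (σ : VertexOrdering V) : VertexOrdering V :=
  σ.trans Fin.revPerm

/-- `τ` is obtained from `σ` or from its mirror by a permutation of the vertices that moves each
vertex to itself or to one of its true twins. -/
def SameUpToReversalAndTwins (G : SimpleGraph V) (σ τ : VertexOrdering V) : Prop :=
  ∃ p : Equiv.Perm V, (∀ v : V, p v = v ∨ TrueTwins G v (p v)) ∧
    (τ = p.trans σ ∨ τ = p.trans (VertexOrdering.mirror σ))

/-- `σ` sorts the intervals of the realizer by left bound (equal bounds in any order). -/
def IsIntervalOrdering (left : V → ℝ) (σ : VertexOrdering V) : Prop :=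
  ∀ u v : V, σ u < σ v → left u ≤ left v

/-- Every closed neighbourhood `N[v]` occurs consecutively in `σ`. -/
def IsConsecutiveNeighbourhoodOrdering (G : SimpleGraph V) (σ : VertexOrdering V) : Prop :=
  ∀ v : V, (σ '' insert v (G.neighborSet v)).OrdConnected

/-- For `a < b < c`, if `ac` is an edge then so are `ab` and `bc`. -/
def IsLeftRightOrdering (G : SimpleGraph V) (σ : VertexOrdering V) : Prop :=
  ∀ a b c : V, σ a < σ b → σ b < σ c → G.Adj a c → G.Adj a b ∧ G.Adj b c

/-- The centre of every induced `P₃` lies between its two ends. -/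
def IsIndifferenceOrdering (G : SimpleGraph V) (σ : VertexOrdering V) : Prop :=
  ∀ a b c : V, a ≠ c → G.Adj a b → G.Adj b c → ¬ G.Adj a c →
    (σ a < σ b ∧ σ b < σ c) ∨ (σ c < σ b ∧ σ b < σ a)

/-- The neighbours of each vertex that precede it form a clique. -/
def IsSimplicialEliminationOrdering (G : SimpleGraph V) (σ : VertexOrdering V) : Prop :=
  ∀ v : V, G.IsClique {u : V | G.Adj v u ∧ σ u < σ v}

/-- Both the ordering and its mirror are simplicial elimination orderings. -/
def IsBisimplicialEliminationOrdering (G : SimpleGraph V) (σ : VertexOrdering V) : Prop :=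
  IsSimplicialEliminationOrdering G σ ∧
    IsSimplicialEliminationOrdering G (VertexOrdering.mirror σ)

/-- The adjacency list of `u`, sorted according to `prio`. -/
noncomputable def sortedAdj (G : SimpleGraph V) (prio : VertexOrdering V) (u : V) : List V :=
  open Classical in (List.ofFn prio.symm).filter (fun w => G.Adj u w)

/-- `σ` is a visit ordering of `minBFS(r)`: the vertices are sorted once by nondecreasing degree
(ties broken arbitrarily), all adjacency lists are sorted accordingly, and `σ` is the order in
which BFS from `r` visits the vertices. Each round visits one vertex, so `|V|` rounds suffice. -/
def IsMinBFSOrdering (G : SimpleGraph V) (r : V) (σ : VertexOrdering V) : Prop :=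
  ∃ prio : VertexOrdering V,
    (∀ u v : V, (G.neighborSet u).ncard < (G.neighborSet v).ncard → prio u < prio v) ∧
    bfsVisit (sortedAdj G prio) (Fintype.card V) [] [r] = List.ofFn σ.symm

end UIG

namespace UIG

/-! ### Closed neighbourhoods and true twins -/

section General

variable {V : Type*} {G : SimpleGraph V}

/-! Everything passes through the Left-Right condition. Consecutive neighbourhoods are equivalent to
it, and bisimplicial elimination is equivalent to indifference, in any finite graph. Indifference
implies Left-Right only by connectedness: shortest paths are monotone, so an edge can be pushed
along one (`monotone_geodesic`).

Uniqueness: a segment of one Left-Right ordering that avoids `N[v]` is connected, so any other one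
keeps it on one side of `v` (`same_side`). Hence the order of the two ends fixes that of all
nonadjacent pairs. Adjacent vertices with distinct closed neighbourhoods are centre and end of an
induced `P₃`, so their order is fixed too. Only true twins, which form blocks, stay free;
`classRank` numbers the blocks.

Permuting twins and reflecting the line preserve unit realizers, so the whole class consists of
interval orderings. In BFS from the first vertex of a Left-Right ordering, marked vertices form an
initial segment, and newly marked ones have nested closed neighbourhoods. Sorting by degree thus
reproduces the ordering up to twins (`bfsVisit_eq`). -/

/-- The closed neighbourhoods of `u` and `v` agree. -/
def SameClosedNbhd (G : SimpleGraph V) (u v : V) : Prop :=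
  ∀ x : V, (x = u ∨ G.Adj u x) ↔ (x = v ∨ G.Adj v x)

theorem SameClosedNbhd.refl (u : V) : SameClosedNbhd G u u := fun _ => Iff.rfl

theorem SameClosedNbhd.symm {u v : V} (h : SameClosedNbhd G u v) : SameClosedNbhd G v u :=
  fun x => (h x).symm

theorem SameClosedNbhd.trans {u v w : V} (h : SameClosedNbhd G u v)
    (h' : SameClosedNbhd G v w) : SameClosedNbhd G u w :=
  fun x => (h x).trans (h' x)

theorem SameClosedNbhd.adj {u v : V} (h : SameClosedNbhd G u v) (huv : u ≠ v) : G.Adj u v := by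
  have := (h v).2 (Or.inl rfl)
  tauto

theorem sameClosedNbhd_iff {u v : V} :
    SameClosedNbhd G u v ↔ v = u ∨ TrueTwins G u v := by
  constructor
  · intro h
    by_cases huv : v = u
    · exact Or.inl huv
    · have ha := h.adj (Ne.symm huv)
      refine Or.inr ⟨?_, ha⟩
      ext x
      have hx := h x
      simp only [Set.mem_sdiff, SimpleGraph.mem_neighborSet, Set.mem_singleton_iff]
      constructor
      · rintro ⟨h1, h2⟩
        have h3 := h1.ne
        exact ⟨(hx.1 (Or.inr h1)).resolve_left h2, h3.symm⟩
      · rintro ⟨h1, h2⟩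
        have h3 := h1.ne
        exact ⟨(hx.2 (Or.inr h1)).resolve_left h2, h3.symm⟩
  · rintro (rfl | ⟨h, ha⟩)
    · exact SameClosedNbhd.refl _
    · intro x
      have hx := Set.ext_iff.1 h x
      simp only [Set.mem_sdiff, SimpleGraph.mem_neighborSet, Set.mem_singleton_iff] at hx
      by_cases h1 : x = u
      · subst h1; simp [ha.symm]
      · by_cases h2 : x = v
        · subst h2; simp [ha]
        · simp only [h1, h2, false_or, not_false_eq_true, and_true] at hx ⊢
          exact hx

/-- Replace one endpoint at a time; the case `p u = v` needs the closed form of the neighbourhoods.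
-/
theorem adj_perm_iff {p : Equiv.Perm V} (hp : ∀ v, SameClosedNbhd G v (p v)) (u v : V) :
    G.Adj (p u) (p v) ↔ G.Adj u v := by
  by_cases huv : u = v
  · subst huv; simp
  · have huv' : p u ≠ p v := fun h => huv (p.injective h)
    have h1 := hp u v
    have h2 := hp v (p u)
    have h3 := G.adj_comm v (p u)
    have h4 := G.adj_comm (p v) (p u)
    have h5 : (v = p u) ↔ (p u = v) := eq_comm
    have h6 : v ≠ u := Ne.symm huv
    tauto

theorem isUnitRealizer_iff {left : V → ℝ} :
    IsUnitRealizer G left ↔ ∀ u v : V, u ≠ v →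
      (G.Adj u v ↔ left u ≤ left v + 1 ∧ left v ≤ left u + 1) := by
  unfold IsUnitRealizer
  have : ∀ a b : ℝ, (Set.Icc a (a + 1) ∩ Set.Icc b (b + 1)).Nonempty ↔ a ≤ b + 1 ∧ b ≤ a + 1 := by
    intro a b
    rw [Set.Icc_inter_Icc, Set.nonempty_Icc]
    simp only [le_inf_iff, sup_le_iff]
    constructor
    · rintro ⟨⟨_, h⟩, h', _⟩; exact ⟨h', h⟩
    · rintro ⟨h, h'⟩; exact ⟨⟨by linarith, h'⟩, h, by linarith⟩
  simp only [this]

end General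

variable {V : Type*} [Fintype V] {G : SimpleGraph V}

theorem sameUpToReversalAndTwins_iff {σ τ : VertexOrdering V} :
    SameUpToReversalAndTwins G σ τ ↔ ∃ p : Equiv.Perm V, (∀ v, SameClosedNbhd G v (p v)) ∧
      (τ = p.trans σ ∨ τ = p.trans (VertexOrdering.mirror σ)) := by
  simp only [SameUpToReversalAndTwins, sameClosedNbhd_iff]

theorem mirror_lt_mirror {σ : VertexOrdering V} {u v : V} :
    VertexOrdering.mirror σ u < VertexOrdering.mirror σ v ↔ σ v < σ u := by
  simp [VertexOrdering.mirror]

theorem mirror_mirror (σ : VertexOrdering V) :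
    VertexOrdering.mirror (VertexOrdering.mirror σ) = σ := by
  ext v; simp [VertexOrdering.mirror]

/-! ### The local characterizations -/

theorem IsLeftRightOrdering.mirror {σ : VertexOrdering V} (h : IsLeftRightOrdering G σ) :
    IsLeftRightOrdering G (VertexOrdering.mirror σ) := by
  intro a b c hab hbc hac
  rw [mirror_lt_mirror] at hab hbc
  exact ⟨(h c b a hbc hab hac.symm).2.symm, (h c b a hbc hab hac.symm).1.symm⟩

theorem IsLeftRightOrdering.perm_trans {σ : VertexOrdering V} (h : IsLeftRightOrdering G σ)
    {p : Equiv.Perm V} (hp : ∀ v, SameClosedNbhd G v (p v)) :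
    IsLeftRightOrdering G (p.trans σ) := by
  intro a b c hab hbc hac
  have := h (p a) (p b) (p c) hab hbc ((adj_perm_iff hp a c).2 hac)
  rwa [adj_perm_iff hp, adj_perm_iff hp] at this

/-- An edge `ac` gives consecutivity in both `N[a]` and `N[c]`, hence both new edges. Conversely, a
vertex other than `v` strictly between two members of `N[v]` lies between `v` and one of them. -/
theorem isConsecutiveNeighbourhoodOrdering_iff {σ : VertexOrdering V} :
    IsConsecutiveNeighbourhoodOrdering G σ ↔ IsLeftRightOrdering G σ := by
  have key : ∀ {x v : V}, σ x ∈ σ '' insert v (G.neighborSet v) ↔ x = v ∨ G.Adj v x := by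
    intro x v
    simp
  constructor
  · intro h a b c hab hbc hac
    have h1 := (h a).out (key.2 (Or.inl rfl)) (key.2 (Or.inr hac)) ⟨hab.le, hbc.le⟩
    have h2 := (h c).out (key.2 (Or.inr hac.symm)) (key.2 (Or.inl rfl)) ⟨hab.le, hbc.le⟩
    rw [key] at h1 h2
    refine ⟨h1.resolve_left ?_, (h2.resolve_left ?_).symm⟩
    · rintro rfl; exact lt_irrefl _ hab
    · rintro rfl; exact lt_irrefl _ hbc
  · intro h v
    refine ⟨?_⟩
    intro x hx z hz y hy
    obtain ⟨x, rfl⟩ := σ.surjective x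
    obtain ⟨y, rfl⟩ := σ.surjective y
    obtain ⟨z, rfl⟩ := σ.surjective z
    rw [key] at hx hz ⊢
    obtain ⟨h1, h2⟩ := hy
    rcases h1.eq_or_lt with h1 | h1
    · rwa [← σ.injective h1]
    rcases h2.eq_or_lt with h2 | h2
    · rwa [σ.injective h2]
    rcases lt_trichotomy (σ v) (σ y) with h3 | h3 | h3
    · refine Or.inr (h v y z h3 h2 (hz.resolve_left ?_)).1
      rintro rfl; exact lt_asymm h2 h3
    · exact Or.inl (σ.injective h3).symm
    · refine Or.inr (h x y v h1 h3 (hx.resolve_left ?_).symm).2.symm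
      rintro rfl; exact lt_asymm h1 h3

/-- Two nonadjacent neighbours on the same side of `v` are exactly an induced `P₃` whose centre `v`
is not between its ends. -/
theorem isBisimplicialEliminationOrdering_iff {σ : VertexOrdering V} :
    IsBisimplicialEliminationOrdering G σ ↔ IsIndifferenceOrdering G σ := by
  constructor
  · rintro ⟨h1, h2⟩ a b c hne hab hbc hac
    rcases lt_or_gt_of_ne (fun h => hab.ne (σ.injective h)) with h3 | h3 <;>
    rcases lt_or_gt_of_ne (fun h => hbc.ne (σ.injective h)) with h4 | h4
    · exact Or.inl ⟨h3, h4⟩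
    · exact absurd (h1 b (show a ∈ _ from ⟨hab.symm, h3⟩) (show c ∈ _ from ⟨hbc, h4⟩) hne) hac
    · exact absurd (h2 b (show a ∈ _ from ⟨hab.symm, mirror_lt_mirror.2 h3⟩)
        (show c ∈ _ from ⟨hbc, mirror_lt_mirror.2 h4⟩) hne) hac
    · exact Or.inr ⟨h4, h3⟩
  · intro h
    refine ⟨?_, ?_⟩
    · rintro v a ⟨ha, ha'⟩ c ⟨hc, hc'⟩ hne
      by_contra hac
      rcases h a v c hne ha.symm hc hac with ⟨h1, h2⟩ | ⟨h1, h2⟩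
      · exact lt_asymm hc' h2
      · exact lt_asymm ha' h2
    · rintro v a ⟨ha, ha'⟩ c ⟨hc, hc'⟩ hne
      rw [mirror_lt_mirror] at ha' hc'
      by_contra hac
      rcases h a v c hne ha.symm hc hac with ⟨h1, h2⟩ | ⟨h1, h2⟩
      · exact lt_asymm ha' h1
      · exact lt_asymm hc' h1

theorem IsLeftRightOrdering.isIndifferenceOrdering {σ : VertexOrdering V}
    (h : IsLeftRightOrdering G σ) : IsIndifferenceOrdering G σ := by
  intro a b c hne hab hbc hac
  have h1 : σ a ≠ σ b := fun h => hab.ne (σ.injective h)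
  have h2 : σ b ≠ σ c := fun h => hbc.ne (σ.injective h)
  have h3 : σ a ≠ σ c := fun h => hne (σ.injective h)
  rcases lt_or_gt_of_ne h1 with h1 | h1 <;> rcases lt_or_gt_of_ne h2 with h2 | h2
  · exact Or.inl ⟨h1, h2⟩
  · rcases lt_or_gt_of_ne h3 with h3 | h3
    · exact absurd (h a c b h3 h2 hab).1 hac
    · exact absurd (h c a b h3 h1 hbc.symm).1.symm hac
  · rcases lt_or_gt_of_ne h3 with h3 | h3
    · exact absurd (h b a c h1 h3 hbc).2 hac
    · exact absurd (h b c a h2 h3 hab.symm).2.symm hac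
  · exact Or.inr ⟨h2, h1⟩

/-- In an indifference ordering of a connected graph, shortest paths are monotone. -/
theorem IsIndifferenceOrdering.monotone_geodesic {σ : VertexOrdering V}
    (h : IsIndifferenceOrdering G σ) (hconn : G.Connected) (b : V) :
    ∀ (d : ℕ) (a x : V), G.Adj a x → G.dist a b = d + 1 → G.dist x b = d →
      (σ a < σ b → σ a < σ x ∧ σ x ≤ σ b) ∧ (σ b < σ a → σ b ≤ σ x ∧ σ x < σ a) := by
  intro d
  induction d with
  | zero =>
    intro a x hax _ hx
    have : x = b := (hconn.dist_eq_zero_iff).1 hx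
    subst this
    exact ⟨fun h => ⟨h, le_rfl⟩, fun h => ⟨le_rfl, h⟩⟩
  | succ d ih =>
    intro a x hax ha hx
    have hxb : x ≠ b := by rintro rfl; simp at hx
    obtain ⟨y, hxy, hy⟩ : ∃ y, G.Adj x y ∧ G.dist y b = d := by
      obtain ⟨w, hw⟩ := hconn.exists_walk_length_eq_dist x b
      cases w with
      | nil => exact absurd rfl hxb
      | cons hadj w' =>
        rename_i y
        refine ⟨y, hadj, ?_⟩
        have h1 := SimpleGraph.dist_le w'
        have h2 := hconn.dist_triangle (u := x) (v := y) (w := b)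
        have h3 := SimpleGraph.dist_eq_one_iff_adj.2 hadj
        simp only [SimpleGraph.Walk.length_cons] at hw
        omega
    -- The distances of `a` and `y` to `b` differ by two, so `a`, `x`, `y` induce a `P₃`. Its centre
    -- `x` lies between, and the step from `x` to `y` fixes the direction.
    have hay : ¬ G.Adj a y := by
      intro hay
      have h2 := hconn.dist_triangle (u := a) (v := y) (w := b)
      have h3 := SimpleGraph.dist_eq_one_iff_adj.2 hay
      omega
    have hne : a ≠ y := by rintro rfl; omega
    have ih' := ih x y hxy hx hy
    have hP := h a x y hne hax hxy hay
    have hxb' : σ x ≠ σ b := fun h => hxb (σ.injective h)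
    rcases lt_or_gt_of_ne hxb' with h1 | h1
    · have h2 := ih'.1 h1
      rcases hP with h3 | h3
      · exact ⟨fun _ => ⟨h3.1, h1.le⟩, fun h4 => absurd (h3.1.trans h1) (lt_asymm h4)⟩
      · exact absurd h3.1 (lt_asymm h2.1)
    · have h2 := ih'.2 h1
      rcases hP with h3 | h3
      · exact absurd h3.2 (lt_asymm h2.2)
      · exact ⟨fun h4 => absurd (h1.trans h3.2) (lt_asymm h4), fun _ => ⟨h1.le, h3.2⟩⟩

theorem IsIndifferenceOrdering.isLeftRightOrdering {σ : VertexOrdering V}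
    (h : IsIndifferenceOrdering G σ) (hconn : G.Connected) : IsLeftRightOrdering G σ := by
  have right : ∀ a b c : V, σ a < σ b → σ b < σ c → G.Adj a b → G.Adj a c → G.Adj b c := by
    intro a b c hab hbc h1 h2
    by_contra h3
    rcases h b a c (by rintro rfl; exact lt_irrefl _ hbc) h1.symm h2 h3 with h4 | h4
    · exact lt_asymm hab h4.1
    · exact lt_asymm (hab.trans hbc) h4.1
  have left : ∀ a b c : V, σ a < σ b → σ b < σ c → G.Adj b c → G.Adj a c → G.Adj a b := by
    intro a b c hab hbc h1 h2
    by_contra h3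
    rcases h a c b (by rintro rfl; exact lt_irrefl _ hab) h2 h1.symm h3 with h4 | h4
    · exact lt_asymm hbc h4.2
    · exact lt_asymm (hab.trans hbc) h4.2
  -- The left end of the edge `ac` advances along a shortest path towards `b`, staying before `b`;
  -- `right` keeps each new pair with `c` adjacent.
  have key : ∀ (d : ℕ) (a b c : V), G.dist a b = d + 1 → σ a < σ b → σ b < σ c → G.Adj a c →
      G.Adj b c := by
    intro d
    induction d with
    | zero =>
      intro a b c hd hab hbc hac
      exact right a b c hab hbc (SimpleGraph.dist_eq_one_iff_adj.1 hd) hac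
    | succ d ih =>
      intro a b c hd hab hbc hac
      obtain ⟨x, hax, hx⟩ : ∃ y, G.Adj a y ∧ G.dist y b = d + 1 := by
        obtain ⟨w, hw⟩ := hconn.exists_walk_length_eq_dist a b
        cases w with
        | nil => exact absurd hab (lt_irrefl _)
        | cons hadj w' =>
          rename_i y
          refine ⟨y, hadj, ?_⟩
          have h1 := SimpleGraph.dist_le w'
          have h2 := hconn.dist_triangle (u := a) (v := y) (w := b)
          have h3 := SimpleGraph.dist_eq_one_iff_adj.2 hadj
          simp only [SimpleGraph.Walk.length_cons] at hw
          omega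
      obtain ⟨h1, h2⟩ := (h.monotone_geodesic hconn b (d + 1) a x hax hd hx).1 hab
      have h3 : σ x ≠ σ b := by
        intro h3
        rw [σ.injective h3] at hx
        simp at hx
      have h4 := lt_of_le_of_ne h2 h3
      exact ih x b c hx h4 hbc (right a x c h1 (h4.trans hbc) hax hac)
  intro a b c hab hbc hac
  have hd : G.dist a b ≠ 0 := by
    rw [Ne, hconn.dist_eq_zero_iff]
    rintro rfl; exact lt_irrefl _ hab
  have := key (G.dist a b - 1) a b c (by omega) hab hbc hac
  exact ⟨left a b c hab hbc this hac, this⟩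

/-! ### Realizers -/

theorem IsIntervalOrdering.isLeftRightOrdering {left : V → ℝ} {σ : VertexOrdering V}
    (hl : IsUnitRealizer G left) (h : IsIntervalOrdering left σ) : IsLeftRightOrdering G σ := by
  rw [isUnitRealizer_iff] at hl
  intro a b c hab hbc hac
  have h1 : a ≠ b := by rintro rfl; exact lt_irrefl _ hab
  have h2 : b ≠ c := by rintro rfl; exact lt_irrefl _ hbc
  have h3 := (hl a c hac.ne).1 hac
  have h4 := h _ _ hab
  have h5 := h _ _ hbc
  rw [hl a b h1, hl b c h2]
  refine ⟨⟨?_, ?_⟩, ?_, ?_⟩ <;> linarith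

theorem exists_interval_of_sameUpToReversalAndTwins {left : V → ℝ} {σ τ : VertexOrdering V}
    (hl : IsUnitRealizer G left) (h : IsIntervalOrdering left σ)
    (hτ : SameUpToReversalAndTwins G σ τ) :
    ∃ left' : V → ℝ, IsUnitRealizer G left' ∧ IsIntervalOrdering left' τ := by
  rw [sameUpToReversalAndTwins_iff] at hτ
  simp only [isUnitRealizer_iff] at hl ⊢
  obtain ⟨p, hp, rfl | rfl⟩ := hτ
  · refine ⟨fun v => left (p v), ?_, fun u v huv => h _ _ huv⟩
    intro u v huv
    rw [← adj_perm_iff hp, hl _ _ (fun h => huv (p.injective h))]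
  -- Reflected intervals, translated by one.
  · refine ⟨fun v => - left (p v), ?_, fun u v huv => neg_le_neg (h _ _ (mirror_lt_mirror.1 huv))⟩
    intro u v huv
    rw [← adj_perm_iff hp, hl _ _ (fun h => huv (p.injective h))]
    constructor <;> rintro ⟨h1, h2⟩ <;> constructor <;> linarith

/-! ### Sorting -/

theorem exists_ordering_monotone {α : Type*} [LinearOrder α] (f : V → α) :
    ∃ σ : VertexOrdering V, Monotone (f ∘ σ.symm) := by
  let e := Fintype.equivFin V
  let s := Tuple.sort (f ∘ e.symm)
  refine ⟨(s.trans e.symm).symm, ?_⟩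
  exact Tuple.monotone_sort (f ∘ e.symm)

theorem monotone_comp_symm_iff {α : Type*} [LinearOrder α] {f : V → α} {σ : VertexOrdering V} :
    Monotone (f ∘ σ.symm) ↔ ∀ u v, σ u < σ v → f u ≤ f v := by
  constructor
  · intro h u v huv
    simpa using h huv.le
  · intro h i j hij
    rcases hij.eq_or_lt with rfl | hij
    · exact le_rfl
    · exact h _ _ (by simpa using hij)

/-- Sorting determines the sequence of values, so two sortings differ by a permutation within the
fibres of `f`. -/
theorem eq_of_monotone_comp_symm {α : Type*} [LinearOrder α] {f : V → α} {σ τ : VertexOrdering V}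
    (hσ : Monotone (f ∘ σ.symm)) (hτ : Monotone (f ∘ τ.symm)) (v : V) :
    f (σ.symm (τ v)) = f v := by
  have hτ' : Monotone ((f ∘ σ.symm) ∘ (τ.symm.trans σ : Equiv.Perm _)) := by
    convert hτ using 1
    ext i; simp
  have := Tuple.unique_monotone (f := f ∘ σ.symm) (σ := Equiv.refl _) hσ hτ'
  have := congrFun this (τ v)
  simpa using this


/-! ### Uniqueness of Left-Right orderings -/

/-- Some edge of a walk crosses the cut between `u` and `v`; the Left-Right property shrinks it from
both ends. -/
theorem IsLeftRightOrdering.adj_of_succ {σ : VertexOrdering V} (h : IsLeftRightOrdering G σ)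
    (hconn : G.Connected) {u v : V} (huv : (σ v : ℕ) = σ u + 1) : G.Adj u v := by
  obtain ⟨w⟩ := hconn.preconnected u v
  obtain ⟨d, -, h1, h2⟩ := w.exists_boundary_dart {x | σ x ≤ σ u} (show σ u ≤ σ u from le_rfl)
    (fun hv : σ v ≤ σ u => by rw [Fin.le_def] at hv; omega)
  have hadj : G.Adj d.fst d.snd := d.adj
  replace h1 : σ d.fst ≤ σ u := h1
  replace h2 : σ u < σ d.snd := not_le.1 h2
  have h3 : σ v ≤ σ d.snd := by rw [Fin.le_def]; rw [Fin.lt_def] at h2; omega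
  have huv' : σ u < σ v := by rw [Fin.lt_def]; omega
  have hv : G.Adj d.fst v := by
    rcases h3.eq_or_lt with h3 | h3
    · rwa [σ.injective h3]
    · exact (h _ _ _ (h1.trans_lt huv') h3 hadj).1
  rcases h1.eq_or_lt with h1 | h1
  · rwa [← σ.injective h1]
  · exact (h _ _ _ h1 huv' hv).2

/-- Vertices of a segment of a Left-Right ordering without neighbours of `v` lie on the same side
of `v` in any other Left-Right ordering. -/
theorem IsLeftRightOrdering.same_side {σ τ : VertexOrdering V} (hσ : IsLeftRightOrdering G σ)
    (hτ : IsLeftRightOrdering G τ) (hconn : G.Connected) {v x y : V}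
    (hxy : σ x ≤ σ y) (hv : ∀ w, σ x ≤ σ w → σ w ≤ σ y → w ≠ v ∧ ¬ G.Adj w v) :
    τ x < τ v ↔ τ y < τ v := by
  have key : ∀ (d : ℕ) (y : V), (σ y : ℕ) = σ x + d →
      (∀ w, σ x ≤ σ w → σ w ≤ σ y → w ≠ v ∧ ¬ G.Adj w v) → (τ x < τ v ↔ τ y < τ v) := by
    intro d
    induction d with
    | zero =>
      intro y hy _
      rw [σ.injective (Fin.ext hy)]
    | succ d ih =>
      intro y hy hv
      obtain ⟨z, hz⟩ := σ.surjective ⟨σ x + d, by have := (σ y).2; omega⟩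
      have hz' : (σ z : ℕ) = σ x + d := by rw [hz]
      rw [ih z hz' (fun w h1 h2 => hv w h1 (h2.trans (by rw [Fin.le_def]; omega)))]
      -- If `τ` placed `v` between `z` and `y`, this edge would make both adjacent to `v`.
      have hzy := hσ.adj_of_succ hconn (u := z) (v := y) (by omega)
      obtain ⟨hz1, hz2⟩ := hv z (by rw [Fin.le_def]; omega) (by rw [Fin.le_def]; omega)
      obtain ⟨hy1, hy2⟩ := hv y (by rw [Fin.le_def]; omega) le_rfl
      have hz3 : τ z ≠ τ v := fun h => hz1 (τ.injective h)
      have hy3 : τ y ≠ τ v := fun h => hy1 (τ.injective h)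
      constructor
      · intro h1
        by_contra h2
        exact hz2 (hτ z v y h1 (lt_of_le_of_ne (not_lt.1 h2) hy3.symm) hzy).1
      · intro h1
        by_contra h2
        exact hy2 (hτ y v z h1 (lt_of_le_of_ne (not_lt.1 h2) hz3.symm) hzy.symm).1
  rw [Fin.le_def] at hxy
  exact key (σ y - σ x) y (by omega) hv

/-- Slide `u` to `r` with `v` fixed, then `v` to `s` with `r` fixed; each slide avoids the closed
neighbourhood of the fixed vertex. -/
theorem IsLeftRightOrdering.lt_iff_of_not_adj {σ τ : VertexOrdering V}
    (hσ : IsLeftRightOrdering G σ) (hτ : IsLeftRightOrdering G τ) (hconn : G.Connected)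
    {r s u v : V} (hr : ∀ w, σ r ≤ σ w) (hs : ∀ w, σ w ≤ σ s)
    (huv : σ u < σ v) (hadj : ¬ G.Adj u v) : τ u < τ v ↔ τ r < τ s := by
  have h1 : ∀ w, σ w ≤ σ u → w ≠ v ∧ ¬ G.Adj w v := by
    intro w hw
    refine ⟨fun h => ?_, fun h => ?_⟩
    · subst h; exact absurd huv (not_lt.2 hw)
    · rcases hw.eq_or_lt with hw | hw
      · exact hadj (σ.injective hw ▸ h)
      · exact hadj (hσ _ _ _ hw huv h).2
  have hrv := h1 r (hr u)
  have h2 : ∀ w, σ v ≤ σ w → w ≠ r ∧ ¬ G.Adj w r := by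
    intro w hw
    refine ⟨fun h => ?_, fun h => ?_⟩
    · subst h; exact absurd (huv.trans_le hw) (not_lt.2 (hr u))
    · rcases hw.eq_or_lt with hw | hw
      · exact hrv.2 (σ.injective hw ▸ h.symm)
      · exact hrv.2 (hσ _ _ _ ((hr u).trans_lt huv) hw h.symm).1
  have h3 := hσ.same_side hτ hconn (hr u) (v := v) (fun w _ h => h1 w h)
  have h4 := hσ.same_side hτ hconn (hs v) (v := r) (fun w h _ => h2 w h)
  have h5 : τ v ≠ τ r := fun h => hrv.1 (τ.injective h.symm)
  have h6 : τ s ≠ τ r := fun h => (h2 s (hs v)).1 (τ.injective h)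
  rw [← h3, ← not_iff_not, not_lt, not_lt, h5.le_iff_lt, h6.le_iff_lt, h4]

theorem IsLeftRightOrdering.lt_iff_of_not_sameClosedNbhd {σ τ : VertexOrdering V}
    (hσ : IsLeftRightOrdering G σ) (hτ : IsLeftRightOrdering G τ) (hconn : G.Connected)
    {r s : V} (hr : ∀ w, σ r ≤ σ w) (hs : ∀ w, σ w ≤ σ s) (hrs : τ r ≤ τ s)
    {u v : V} (huv : ¬ SameClosedNbhd G u v) : σ u < σ v ↔ τ u < τ v := by
  have nonadj : ∀ u v : V, u ≠ v → ¬ G.Adj u v → σ u < σ v → τ u < τ v := by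
    intro u v hne hadj h
    refine (hσ.lt_iff_of_not_adj hτ hconn hr hs h hadj).2 (lt_of_le_of_ne hrs fun h' => ?_)
    have := τ.injective h'
    subst this
    exact absurd h (not_lt.2 ((hs v).trans (hr u)))
  have centre : ∀ u v w : V, σ u < σ v → G.Adj u v → G.Adj u w → w ≠ v → ¬ G.Adj v w →
      τ u < τ v := by
    intro u v w h hadj huw hne hvw
    have hwv : ¬ G.Adj w v := fun h => hvw h.symm
    rcases hσ.isIndifferenceOrdering w u v hne huw.symm hadj hwv with h1 | h1
    · have h2 := nonadj w v hne hwv (h1.1.trans h1.2)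
      rcases hτ.isIndifferenceOrdering w u v hne huw.symm hadj hwv with h3 | h3
      · exact h3.2
      · exact absurd h2 (lt_asymm (h3.1.trans h3.2))
    · exact absurd h (lt_asymm h1.1)
  have centre' : ∀ u v w : V, σ u < σ v → G.Adj u v → G.Adj v w → w ≠ u → ¬ G.Adj u w →
      τ u < τ v := by
    intro u v w h hadj hvw hne huw
    rcases hσ.isIndifferenceOrdering u v w hne.symm hadj hvw huw with h1 | h1
    · have h2 := nonadj u w hne.symm huw (h1.1.trans h1.2)
      rcases hτ.isIndifferenceOrdering u v w hne.symm hadj hvw huw with h3 | h3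
      · exact h3.1
      · exact absurd h2 (lt_asymm (h3.1.trans h3.2))
    · exact absurd h (lt_asymm h1.2)
  have key : ∀ u v : V, ¬ SameClosedNbhd G u v → σ u < σ v → τ u < τ v := by
    intro u v hT h
    have hne : u ≠ v := by rintro rfl; exact lt_irrefl _ h
    by_cases hadj : G.Adj u v
    · unfold SameClosedNbhd at hT
      push Not at hT
      obtain ⟨x, ⟨h1, h2, h3⟩ | ⟨⟨h1, h2⟩, h3⟩⟩ := hT
      · refine centre u v x h hadj (h1.resolve_left ?_) h2 h3
        rintro rfl; exact h3 hadj.symm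
      · refine centre' u v x h hadj (h3.resolve_left ?_) h1 h2
        rintro rfl; exact h2 hadj
    · exact nonadj u v hne hadj h
  refine ⟨key u v huv, fun h => ?_⟩
  by_contra h'
  have hne : σ u ≠ σ v := fun h => huv (σ.injective h ▸ SameClosedNbhd.refl _)
  exact lt_asymm h (key v u (fun h => huv h.symm) (lt_of_le_of_ne (not_lt.1 h') hne.symm))

/-- The number of vertices before `v` that are neither `v` nor a true twin of `v`. -/
noncomputable def classRank (G : SimpleGraph V) (σ : VertexOrdering V) (v : V) : ℕ :=
  {w : V | ¬ SameClosedNbhd G w v ∧ σ w < σ v}.ncard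

/-- Twin classes are blocks, which makes `classRank` monotone and able to separate them. -/
theorem IsLeftRightOrdering.sameClosedNbhd_of_between {σ : VertexOrdering V}
    (hσ : IsLeftRightOrdering G σ) {u w v : V} (huv : SameClosedNbhd G u v)
    (huw : σ u ≤ σ w) (hwv : σ w ≤ σ v) : SameClosedNbhd G u w := by
  rcases huw.eq_or_lt with huw | huw
  · rw [σ.injective huw]; exact SameClosedNbhd.refl _
  rcases hwv.eq_or_lt with hwv | hwv
  · rwa [σ.injective hwv]
  have hadj : G.Adj u v := huv.adj (by rintro rfl; exact lt_asymm huw hwv)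
  obtain ⟨h1, h2⟩ := hσ u w v huw hwv hadj
  intro x
  by_cases hxu : x = u
  · subst hxu; simp [h1.symm]
  by_cases hxw : x = w
  · subst hxw; simp [h1]
  by_cases hxv : x = v
  · subst hxv; simp [h2, hadj]
  have hx := huv x
  simp only [hxu, hxv, hxw, false_or] at hx ⊢
  have hxw' : σ x ≠ σ w := fun h => hxw (σ.injective h)
  rcases lt_or_gt_of_ne hxw' with h3 | h3
  · constructor
    · intro h
      exact (hσ x w v h3 hwv (hx.1 h).symm).1.symm
    · intro h
      rcases lt_or_gt_of_ne (fun h => hxu (σ.injective h)) with h4 | h4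
      · exact (hσ x u w h4 huw h.symm).1.symm
      · exact (hσ u x v h4 (h3.trans hwv) hadj).1
  · constructor
    · intro h
      exact (hσ u w x huw h3 h).2
    · intro h
      rcases lt_or_gt_of_ne (fun h => hxv (σ.injective h)) with h4 | h4
      · exact (hσ u x v (huw.trans h3) h4 hadj).1
      · exact hx.2 (hσ w v x hwv h4 h).2

theorem IsLeftRightOrdering.classRank_subset {σ : VertexOrdering V}
    (hσ : IsLeftRightOrdering G σ) {u v : V} (huv : σ u ≤ σ v) :
    {w : V | ¬ SameClosedNbhd G w u ∧ σ w < σ u} ⊆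
      {w : V | ¬ SameClosedNbhd G w v ∧ σ w < σ v} := by
  rintro w ⟨h1, h2⟩
  exact ⟨fun h => h1 (hσ.sameClosedNbhd_of_between h h2.le huv), h2.trans_le huv⟩

theorem IsLeftRightOrdering.monotone_classRank {σ : VertexOrdering V}
    (hσ : IsLeftRightOrdering G σ) : Monotone (classRank G σ ∘ σ.symm) :=
  monotone_comp_symm_iff.2 fun _ _ huv =>
    Set.ncard_le_ncard (hσ.classRank_subset huv.le) (Set.toFinite _)

theorem IsLeftRightOrdering.classRank_eq_iff {σ : VertexOrdering V}
    (hσ : IsLeftRightOrdering G σ) {u v : V} :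
    classRank G σ u = classRank G σ v ↔ SameClosedNbhd G u v := by
  have aux : ∀ u v : V, σ u ≤ σ v →
      (classRank G σ u = classRank G σ v ↔ SameClosedNbhd G u v) := by
    intro u v huv
    constructor
    · intro h
      by_contra hT
      have hlt : σ u < σ v := lt_of_le_of_ne huv fun h =>
        hT (σ.injective h ▸ SameClosedNbhd.refl _)
      have heq := Set.eq_of_subset_of_ncard_le (hσ.classRank_subset huv) h.ge (Set.toFinite _)
      -- `u` counts towards the rank of `v` but never towards its own.
      have : u ∈ {w : V | ¬ SameClosedNbhd G w u ∧ σ w < σ u} := by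
        rw [heq]; exact ⟨hT, hlt⟩
      exact lt_irrefl _ this.2
    · intro hT
      unfold classRank
      congr 1
      refine (hσ.classRank_subset huv).antisymm ?_
      rintro w ⟨h1, h2⟩
      refine ⟨fun h => h1 (h.trans hT), ?_⟩
      by_contra h3
      exact h1 ((hσ.sameClosedNbhd_of_between hT (not_lt.1 h3) h2.le).symm.trans hT)
  rcases le_total (σ u) (σ v) with h | h
  · exact aux u v h
  · rw [eq_comm, aux v u h]
    exact ⟨SameClosedNbhd.symm, SameClosedNbhd.symm⟩

/-- Since `τ` need only be sorted by rank, this also proves that rearrangements inside twin classes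
remain Left-Right. -/
theorem IsLeftRightOrdering.exists_perm {σ τ : VertexOrdering V}
    (hσ : IsLeftRightOrdering G σ) (hτ : Monotone (classRank G σ ∘ τ.symm)) :
    ∃ p : Equiv.Perm V, (∀ v, SameClosedNbhd G v (p v)) ∧ τ = p.trans σ := by
  refine ⟨τ.trans σ.symm, fun v => ?_, by ext v; simp⟩
  have := eq_of_monotone_comp_symm hσ.monotone_classRank hτ v
  exact (hσ.classRank_eq_iff.1 this).symm

theorem IsLeftRightOrdering.exists_perm_of_le {σ τ : VertexOrdering V}
    (hσ : IsLeftRightOrdering G σ) (hτ : IsLeftRightOrdering G τ) (hconn : G.Connected)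
    {r s : V} (hr : ∀ w, σ r ≤ σ w) (hs : ∀ w, σ w ≤ σ s) (hrs : τ r ≤ τ s) :
    ∃ p : Equiv.Perm V, (∀ v, SameClosedNbhd G v (p v)) ∧ τ = p.trans σ := by
  refine hσ.exists_perm ?_
  have : classRank G σ = classRank G τ := by
    ext v
    unfold classRank
    congr 1
    ext w
    refine and_congr_right fun h => ?_
    exact hσ.lt_iff_of_not_sameClosedNbhd hτ hconn hr hs hrs h
  rw [this]
  exact hτ.monotone_classRank

theorem exists_first (hconn : G.Connected) (σ : VertexOrdering V) :
    ∃ r, (σ r : ℕ) = 0 ∧ ∀ w, σ r ≤ σ w := by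
  have := hconn.nonempty
  refine ⟨σ.symm ⟨0, Fintype.card_pos⟩, by simp, fun w => ?_⟩
  simp

theorem IsLeftRightOrdering.sameUpToReversalAndTwins {σ τ : VertexOrdering V}
    (hσ : IsLeftRightOrdering G σ) (hτ : IsLeftRightOrdering G τ) (hconn : G.Connected) :
    SameUpToReversalAndTwins G σ τ := by
  rw [sameUpToReversalAndTwins_iff]
  obtain ⟨r, -, hr⟩ := exists_first hconn σ
  obtain ⟨s, -, hs⟩ := exists_first hconn σ.mirror
  have hs' : ∀ w, σ w ≤ σ s := fun w =>
    not_lt.1 fun h => not_lt.2 (hs w) (mirror_lt_mirror.2 h)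
  rcases le_total (τ r) (τ s) with h | h
  · obtain ⟨p, hp, h⟩ := hσ.exists_perm_of_le hτ hconn hr hs' h
    exact ⟨p, hp, Or.inl h⟩
  · have h' : τ.mirror r ≤ τ.mirror s := not_lt.1 fun h'' => not_lt.2 h (mirror_lt_mirror.1 h'')
    obtain ⟨p, hp, h⟩ := hσ.exists_perm_of_le hτ.mirror hconn hr hs' h'
    refine ⟨p, hp, Or.inr ?_⟩
    rw [← mirror_mirror τ, h]
    rfl


/-! ### Breadth first search -/

theorem ncard_neighborSet_add_one (G : SimpleGraph V) (u : V) :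
    (G.neighborSet u).ncard + 1 = {x | x = u ∨ G.Adj u x}.ncard := by
  have : {x | x = u ∨ G.Adj u x} = insert u (G.neighborSet u) := by
    ext x; simp
  rw [this, Set.ncard_insert_of_notMem (by simp) (Set.toFinite _)]

theorem SameClosedNbhd.ncard_eq {u v : V} (h : SameClosedNbhd G u v) :
    (G.neighborSet u).ncard = (G.neighborSet v).ncard := by
  have : {x | x = u ∨ G.Adj u x} = {x | x = v ∨ G.Adj v x} := Set.ext h
  have h1 := ncard_neighborSet_add_one G u
  rw [this, ← ncard_neighborSet_add_one] at h1
  omega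

theorem sameClosedNbhd_or_ncard_lt {u v : V}
    (h : ∀ x, x = u ∨ G.Adj u x → x = v ∨ G.Adj v x) :
    SameClosedNbhd G u v ∨ (G.neighborSet u).ncard < (G.neighborSet v).ncard := by
  rw [or_iff_not_imp_right, not_lt]
  intro hle
  have := Set.eq_of_subset_of_ncard_le (s := {x | x = u ∨ G.Adj u x})
    (t := {x | x = v ∨ G.Adj v x}) h
    (by rw [← ncard_neighborSet_add_one, ← ncard_neighborSet_add_one]; omega) (Set.toFinite _)
  exact Set.ext_iff.1 this

theorem mem_drop_take_ofFn {σ : VertexOrdering V} {i j : ℕ} {w : V} :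
    w ∈ ((List.ofFn σ.symm).take j).drop i ↔ i ≤ σ w ∧ (σ w : ℕ) < j := by
  have hw := (σ w).2
  rw [List.mem_drop_iff_getElem]
  constructor
  · rintro ⟨a, ha, rfl⟩
    simp only [List.length_take, List.length_ofFn] at ha
    simp only [List.getElem_take, List.getElem_ofFn, Equiv.apply_symm_apply]
    omega
  · rintro ⟨h1, h2⟩
    refine ⟨σ w - i, ?_, ?_⟩
    · simp only [List.length_take, List.length_ofFn]; omega
    · simp only [List.getElem_take, List.getElem_ofFn]
      rw [Equiv.symm_apply_eq]
      ext; simp only; omega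

theorem pairwise_ofFn_symm (σ : VertexOrdering V) :
    (List.ofFn σ.symm).Pairwise fun u v => σ u < σ v := by
  rw [List.pairwise_ofFn]
  intro i j hij
  simpa using hij

theorem mem_sortedAdj {prio : VertexOrdering V} {u w : V} :
    w ∈ sortedAdj G prio u ↔ G.Adj u w := by
  simp only [sortedAdj, List.mem_filter, decide_eq_true_eq, and_iff_right_iff_imp]
  intro _
  rw [List.mem_ofFn]
  exact ⟨prio w, by simp⟩

theorem pairwise_sortedAdj (prio : VertexOrdering V) (u : V) :
    (sortedAdj G prio u).Pairwise fun v w => prio v < prio w :=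
  (pairwise_ofFn_symm prio).sublist List.filter_sublist

theorem eq_of_pairwise_lt_of_mem_iff {prio : VertexOrdering V} {l₁ l₂ : List V}
    (h₁ : l₁.Pairwise fun v w => prio v < prio w) (h₂ : l₂.Pairwise fun v w => prio v < prio w)
    (h : ∀ w, w ∈ l₁ ↔ w ∈ l₂) : l₁ = l₂ := by
  refine List.Perm.eq_of_pairwise (fun a b _ _ hab hba => absurd hab (lt_asymm hba)) h₁ h₂ ?_
  rw [List.perm_ext_iff_of_nodup]
  · exact h
  · exact h₁.imp fun h => by rintro rfl; exact lt_irrefl _ h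
  · exact h₂.imp fun h => by rintro rfl; exact lt_irrefl _ h

/-- The state of the search after `i` visits, when the marked vertices are the first `m` ones of
the Left-Right ordering `σ`: the remaining visits follow `σ`. -/
theorem IsLeftRightOrdering.bfsVisit_eq {σ prio : VertexOrdering V}
    (hσ : IsLeftRightOrdering G σ) (hconn : G.Connected)
    (hdeg : ∀ u v : V, (G.neighborSet u).ncard < (G.neighborSet v).ncard → prio u < prio v)
    (htwin : ∀ u v : V, SameClosedNbhd G u v → (σ u : ℕ) ≠ 0 → σ u < σ v → prio u < prio v)
    (k : ℕ) : ∀ i m : ℕ, i + k = Fintype.card V →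
      (∀ w, (σ w : ℕ) < m ↔ ((σ w : ℕ) = 0 ∨ ∃ x, (σ x : ℕ) < i ∧ (w = x ∨ G.Adj x w))) →
      bfsVisit (sortedAdj G prio) k ((List.ofFn σ.symm).take i)
        (((List.ofFn σ.symm).take m).drop i) = List.ofFn σ.symm := by
  induction k with
  | zero =>
    intro i m hi _
    simp only [bfsVisit]
    exact List.take_of_length_le (by simp; omega)
  | succ k ih =>
    intro i m hi hm
    set L := List.ofFn σ.symm with hL
    have hlen : L.length = Fintype.card V := by simp [hL]
    have hin : i < Fintype.card V := by omega
    obtain ⟨u, hu⟩ := σ.surjective ⟨i, hin⟩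
    have hui : (σ u : ℕ) = i := by rw [hu]
    have hLi : L[i]'(by omega) = u := by
      simp only [hL, List.getElem_ofFn]
      rw [Equiv.symm_apply_eq]; exact hu.symm
    have him : i < m := by
      rw [← hui, hm]
      rcases Nat.eq_zero_or_pos i with h0 | h0
      · exact Or.inl (by omega)
      · obtain ⟨x, hx⟩ := σ.surjective ⟨i - 1, by omega⟩
        have hxi : (σ x : ℕ) = i - 1 := by rw [hx]
        exact Or.inr ⟨x, by omega, Or.inr (hσ.adj_of_succ hconn (by omega))⟩
    have hcons : (L.take m).drop i = u :: (L.take m).drop (i + 1) := by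
      rw [List.drop_eq_getElem_cons (by rw [List.length_take]; omega), List.getElem_take, hLi]
    have hsucc : L.take i ++ [u] = L.take (i + 1) := by
      rw [← hLi]; exact List.take_concat_get' L i (by omega)
    have hall : L.take i ++ u :: (L.take m).drop (i + 1) = L.take m := by
      rw [← hcons]
      conv_rhs => rw [← List.take_append_drop i (L.take m), List.take_take, min_eq_left him.le]
    -- the marked vertices after the visit of `u` again form an initial segment
    obtain ⟨m', hmm', hm'⟩ : ∃ m', m ≤ m' ∧ ∀ w, (σ w : ℕ) < m' ↔ (σ w : ℕ) < m ∨ G.Adj u w := by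
      have hex : ∃ b, ∀ w, G.Adj u w → (σ w : ℕ) < b := ⟨Fintype.card V, fun w _ => (σ w).2⟩
      classical
      -- The least strict bound on the positions of neighbours of `u`: an unmarked vertex below it
      -- lies between `u` and a neighbour, or is one.
      refine ⟨max m (Nat.find hex), le_max_left _ _, fun w => ?_⟩
      rw [lt_max_iff]
      refine ⟨?_, Or.imp_right (Nat.find_spec hex w)⟩
      rintro (h | h)
      · exact Or.inl h
      · by_contra hw
        push Not at hw
        refine Nat.find_min hex h fun y hy => ?_
        by_contra hyw
        have hne : σ w ≠ σ y := fun h => hw.2 (σ.injective h ▸ hy)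
        exact hw.2 (hσ u w y (by rw [Fin.lt_def]; omega)
          (lt_of_le_of_ne (by rw [Fin.le_def]; omega) hne) hy).1
    have hfilter : (open Classical in (sortedAdj G prio u).filter
        (fun w => w ∉ L.take i ++ u :: (L.take m).drop (i + 1))) = (L.take m').drop m := by
      rw [hall]
      refine eq_of_pairwise_lt_of_mem_iff (prio := prio)
        ((pairwise_sortedAdj prio u).filter _) ?_ ?_
      · have hpw : ((L.take m').drop m).Pairwise fun u v => σ u < σ v :=
          (pairwise_ofFn_symm σ).sublist ((List.drop_sublist _ _).trans (List.take_sublist _ _))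
        refine hpw.imp_of_mem ?_
        intro a b ha hb hab
        rw [mem_drop_take_ofFn] at ha hb
        have hub : G.Adj u b := ((hm' b).1 hb.2).resolve_left (by omega)
        have ha' : ¬ (σ a : ℕ) < m := by omega
        rw [hm] at ha'
        push Not at ha'
        -- As `a` was unmarked, `N[a]` has no vertex before `u`. Its members before `b` are adjacent
        -- to `b` through the edge `ub`, those after `b` through their edge to `a`. So `N[a] ⊆
        -- N[b]`.
        rcases sameClosedNbhd_or_ncard_lt (G := G) (u := a) (v := b) (by
          intro y hy
          have hyi : i ≤ σ y := by
            by_contra hyi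
            have h1 := ha'.2 y (by omega)
            rcases hy with rfl | hy
            · exact h1.1 rfl
            · exact h1.2 hy.symm
          rcases lt_trichotomy (σ y) (σ b) with h1 | h1 | h1
          · right
            rcases hyi.eq_or_lt with h2 | h2
            · rw [← σ.injective (Fin.ext (hui.trans h2))]; exact hub.symm
            · exact (hσ u y b (by rw [Fin.lt_def]; omega) h1 hub).2.symm
          · exact Or.inl (σ.injective h1)
          · right
            refine (hσ a b y hab h1 (hy.resolve_left ?_)).2
            rintro rfl; exact lt_asymm hab h1) with h | h
        · exact htwin a b h ha'.1 hab
        · exact hdeg a b h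
      · intro w
        have hmem : w ∈ L.take m ↔ (σ w : ℕ) < m := by
          have := mem_drop_take_ofFn (σ := σ) (i := 0) (j := m) (w := w)
          simpa using this
        rw [List.mem_filter, mem_sortedAdj, mem_drop_take_ofFn, hm']
        simp only [decide_eq_true_eq, hmem]
        constructor
        · rintro ⟨h1, h2⟩; exact ⟨by omega, Or.inr h1⟩
        · rintro ⟨h1, h2⟩; exact ⟨h2.resolve_left (by omega), by omega⟩
    have hqueue : (L.take m).drop (i + 1) ++ (L.take m').drop m = (L.take m').drop (i + 1) := by
      have : L.take m' = L.take m ++ (L.take m').drop m := by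
        conv_lhs => rw [← List.take_append_drop m (L.take m'), List.take_take, min_eq_left hmm']
      conv_rhs => rw [this]
      rw [List.drop_append_of_le_length (by rw [List.length_take]; omega)]
    rw [hcons, bfsVisit, hfilter, hqueue, hsucc]
    refine ih (i + 1) m' (by omega) fun w => ?_
    rw [hm', hm]
    constructor
    · rintro ((h | ⟨x, h, h'⟩) | h)
      · exact Or.inl h
      · exact Or.inr ⟨x, by omega, h'⟩
      · exact Or.inr ⟨u, by omega, Or.inr h⟩
    · rintro (h | ⟨x, h, h'⟩)
      · exact Or.inl (Or.inl h)
      · rcases (Nat.lt_succ_iff.1 h).eq_or_lt with h1 | h1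
        · have hxu : x = u := σ.injective (Fin.ext (h1.trans hui.symm))
          subst hxu
          rcases h' with rfl | h'
          · left
            rw [← hm]; omega
          · exact Or.inr h'
        · exact Or.inl (Or.inr ⟨x, h1, h'⟩)

/-- The root enters the queue by hand, so `htwin` exempts the first vertex from agreeing with
`prio`. -/
theorem IsLeftRightOrdering.bfsVisit_first {σ prio : VertexOrdering V}
    (hσ : IsLeftRightOrdering G σ) (hconn : G.Connected)
    (hdeg : ∀ u v : V, (G.neighborSet u).ncard < (G.neighborSet v).ncard → prio u < prio v)
    (htwin : ∀ u v : V, SameClosedNbhd G u v → (σ u : ℕ) ≠ 0 → σ u < σ v → prio u < prio v)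
    {r : V} (hr : (σ r : ℕ) = 0) :
    bfsVisit (sortedAdj G prio) (Fintype.card V) [] [r] = List.ofFn σ.symm := by
  have h := hσ.bfsVisit_eq hconn hdeg htwin (Fintype.card V) 0 1 (by omega) (by simp)
  have h1 : (List.ofFn σ.symm).take 1 = [r] := by
    have hpos : 0 < Fintype.card V := (Nat.zero_le _).trans_lt (σ r).2
    have := List.take_concat_get' (List.ofFn σ.symm) 0 (by simpa using hpos)
    rw [← this]
    simp only [List.take_zero, List.nil_append, List.getElem_ofFn]
    congr 1
    rw [Equiv.symm_apply_eq]
    exact Fin.ext hr.symm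
  rwa [h1, List.take_zero, List.drop_zero] at h

theorem exists_ordering_lex {α : Type*} [LinearOrder α] (f : V → α) (g : V → ℕ) :
    ∃ σ : VertexOrdering V, ∀ u v, σ u < σ v → f u < f v ∨ f u = f v ∧ g u ≤ g v := by
  obtain ⟨σ, hσ⟩ := exists_ordering_monotone fun v => toLex (f v, g v)
  refine ⟨σ, fun u v huv => ?_⟩
  have := monotone_comp_symm_iff.1 hσ u v huv
  rwa [Prod.Lex.toLex_le_toLex] at this

theorem IsMinBFSOrdering.isLeftRightOrdering {r : V} {τ : VertexOrdering V}
    (hconn : G.Connected) (hr : IsLeftAnchor G r) (hτ : IsMinBFSOrdering G r τ) :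
    IsLeftRightOrdering G τ := by
  classical
  obtain ⟨left, hl, hleft⟩ := hr
  obtain ⟨prio, hdeg, hbfs⟩ := hτ
  -- Other bounds may equal that of `r`; the tie-break puts `r` first.
  obtain ⟨σ, hσ⟩ := exists_ordering_lex left fun v => if v = r then 0 else 1
  have hσLR : IsLeftRightOrdering G σ :=
    IsIntervalOrdering.isLeftRightOrdering hl fun u v huv => by
      rcases hσ u v huv with h | h
      · exact h.le
      · exact h.1.le
  have hfirst : ∀ w, σ r ≤ σ w := by
    intro w
    by_contra h
    rw [not_le] at h
    have hne : w ≠ r := by rintro rfl; exact lt_irrefl _ h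
    rcases hσ w r h with h1 | h1
    · exact absurd h1 (not_lt.2 (hleft w))
    · simp [hne] at h1
  have hrank : ∀ w, classRank G σ r ≤ classRank G σ w := by
    intro w
    have := hσLR.monotone_classRank (hfirst w)
    simpa using this
  -- Reordering each twin class by `prio`, root first, gives the Left-Right ordering that the search
  -- must output.
  obtain ⟨ρ, hρ⟩ := exists_ordering_lex (classRank G σ)
    fun v => if v = r then 0 else (prio v : ℕ) + 1
  have hρLR : IsLeftRightOrdering G ρ := by
    obtain ⟨p, hp, rfl⟩ := hσLR.exists_perm (τ := ρ) (monotone_comp_symm_iff.2 fun u v huv => by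
      rcases hρ u v huv with h | h
      · exact h.le
      · exact h.1.le)
    exact hσLR.perm_trans hp
  have hρr : (ρ r : ℕ) = 0 := by
    obtain ⟨s, hs, -⟩ := exists_first hconn ρ
    by_contra h
    have hne : s ≠ r := by rintro rfl; exact h hs
    rcases hρ s r (by rw [Fin.lt_def]; omega) with h1 | h1
    · exact absurd h1 (not_lt.2 (hrank s))
    · simp [hne] at h1
  have := hρLR.bfsVisit_first hconn (prio := prio) hdeg (by
    intro u v hT h0 huv
    have hur : u ≠ r := by rintro rfl; exact h0 hρr
    have hvr : v ≠ r := by rintro rfl; rw [Fin.lt_def] at huv; omega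
    rcases hρ u v huv with h1 | h1
    · exact absurd h1 (not_lt.2 (hσLR.classRank_eq_iff.2 hT).ge)
    · have h2 := h1.2
      simp only [hur, hvr, if_false] at h2
      refine lt_of_le_of_ne (by rw [Fin.le_def]; omega) fun h => ?_
      rw [prio.injective h] at huv
      exact lt_irrefl _ huv) hρr
  rw [hbfs] at this
  have h := List.ofFn_injective this
  have hτρ : τ = ρ := by
    rw [← Equiv.symm_symm τ, ← Equiv.symm_symm ρ]
    exact congrArg Equiv.symm (DFunLike.coe_injective h)
  rwa [hτρ]

theorem IsIntervalOrdering.exists_isMinBFSOrdering {left : V → ℝ} {τ : VertexOrdering V}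
    (hconn : G.Connected) (hl : IsUnitRealizer G left) (h : IsIntervalOrdering left τ) :
    ∃ r : V, IsLeftAnchor G r ∧ IsMinBFSOrdering G r τ := by
  obtain ⟨r, hr, hmin⟩ := exists_first hconn τ
  -- Breaking degree ties by `τ` itself makes twins leave the queue in the order of `τ`.
  obtain ⟨prio, hprio⟩ := exists_ordering_lex (fun v => (G.neighborSet v).ncard)
    fun v => (τ v : ℕ)
  have hdeg : ∀ u v : V, (G.neighborSet u).ncard < (G.neighborSet v).ncard → prio u < prio v := by
    intro u v huv
    by_contra h1
    rcases (not_lt.1 h1).eq_or_lt with h2 | h2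
    · rw [prio.injective h2] at huv; exact lt_irrefl _ huv
    · rcases hprio v u h2 with h3 | h3
      · exact lt_asymm huv h3
      · exact huv.ne h3.1.symm
  refine ⟨r, ⟨left, hl, fun v => ?_⟩, prio, hdeg, ?_⟩
  · rcases (hmin v).eq_or_lt with h1 | h1
    · rw [τ.injective h1]
    · exact h _ _ h1
  · refine (h.isLeftRightOrdering hl).bfsVisit_first hconn hdeg ?_ hr
    · intro u v hT _ huv
      by_contra h1
      rcases (not_lt.1 h1).eq_or_lt with h2 | h2
      · rw [prio.injective h2] at huv; exact lt_irrefl _ huv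
      · rcases hprio v u h2 with h3 | h3
        · exact h3.ne hT.ncard_eq.symm
        · exact absurd huv (not_lt.2 (Fin.le_def.2 h3.2))

end UIG

/-! ### Equivalence of the six kinds of orderings -/

theorem mainTheorem2 {V : Type*} [Fintype V] (G : SimpleGraph V) (hconn : G.Connected)
    (hG : UIG.IsUnitIntervalGraph G) :
    ∃ σ : UIG.VertexOrdering V, ∀ τ : UIG.VertexOrdering V,
      ((∃ left : V → ℝ, UIG.IsUnitRealizer G left ∧ UIG.IsIntervalOrdering left τ) ↔
        UIG.SameUpToReversalAndTwins G σ τ) ∧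
      (UIG.IsConsecutiveNeighbourhoodOrdering G τ ↔ UIG.SameUpToReversalAndTwins G σ τ) ∧
      (UIG.IsLeftRightOrdering G τ ↔ UIG.SameUpToReversalAndTwins G σ τ) ∧
      ((∃ r : V, UIG.IsLeftAnchor G r ∧ UIG.IsMinBFSOrdering G r τ) ↔
        UIG.SameUpToReversalAndTwins G σ τ) ∧
      (UIG.IsIndifferenceOrdering G τ ↔ UIG.SameUpToReversalAndTwins G σ τ) ∧
      (UIG.IsBisimplicialEliminationOrdering G τ ↔ UIG.SameUpToReversalAndTwins G σ τ) := by
  obtain ⟨left, hl⟩ := hG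
  obtain ⟨σ, hσ⟩ := UIG.exists_ordering_monotone left
  have hσint : UIG.IsIntervalOrdering left σ := UIG.monotone_comp_symm_iff.1 hσ
  have hσLR : UIG.IsLeftRightOrdering G σ := hσint.isLeftRightOrdering hl
  refine ⟨σ, fun τ => ?_⟩
  have hint : UIG.SameUpToReversalAndTwins G σ τ →
      ∃ left' : V → ℝ, UIG.IsUnitRealizer G left' ∧ UIG.IsIntervalOrdering left' τ :=
    UIG.exists_interval_of_sameUpToReversalAndTwins hl hσint
  have hLR : UIG.IsLeftRightOrdering G τ ↔ UIG.SameUpToReversalAndTwins G σ τ := by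
    refine ⟨fun h => hσLR.sameUpToReversalAndTwins h hconn, fun h => ?_⟩
    obtain ⟨left', hl', h'⟩ := hint h
    exact h'.isLeftRightOrdering hl'
  have hind : UIG.IsIndifferenceOrdering G τ ↔ UIG.IsLeftRightOrdering G τ :=
    ⟨fun h => h.isLeftRightOrdering hconn, fun h => h.isIndifferenceOrdering⟩
  refine ⟨⟨?_, hint⟩, UIG.isConsecutiveNeighbourhoodOrdering_iff.trans hLR, hLR, ⟨?_, ?_⟩,
    hind.trans hLR, UIG.isBisimplicialEliminationOrdering_iff.trans (hind.trans hLR)⟩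
  · rintro ⟨left', hl', h'⟩
    exact hLR.1 (h'.isLeftRightOrdering hl')
  · rintro ⟨r, hr, h⟩
    exact hLR.1 (h.isLeftRightOrdering hconn hr)
  · intro h
    obtain ⟨left', hl', h'⟩ := hint h
    exact h'.exists_isMinBFSOrdering hconn hl'
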